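/- Let $d\ge 1$, $N\ge 1$ be integers and let $r>0$. A set $A\subset\mathbb R^d$ has reach at least $r$ if every point of $\mathbb R^d$ whose Euclidean distance from $A$ is less than $r$ has a unique closest point in $A$. An equivolume partition of $[0,1]^d$ is a tuple $\mathbf\Omega=(\Omega_1,\dots,\Omega_N)$ of Lebesgue-measurable sets with $\bigcup_{i=1}^N\Omega_i=[0,1]^d$, such that $\Omega_i\cap\Omega_j$ is a Lebesgue null set for all $i\neq j$, and $|\Omega_1|=\dots=|\Omega_N|$. Let $\mathfrak P_N(r)$ be the class of all equivolume partitions of $[0,1]^d$ into $N$ nonempty compact sets of reach at least $r$, and let $\mathfrak P_N^{\mathrm{conv}}$ be the class of all equivolume partitions of $[0,1]^d$ into $N$ nonempty compact convex sets. For such a partition $\mathbf\Omega$ let $\mathcal P_{\mathbf\Omega}=(X_1,\dots,X_N)$ be the stratified sample, where $X_1,\dots,X_N$ are independent random points and $X_i$ is distributed according to the normalized Lebesgue measure on $\Omega_i$. Let $\Delta:([0,1]^d)^N\to\mathbb R$ be (Lebesgue-)measurable and bounded. Then there is a partition $\mathbf\Omega^*\in\mathfrak P_N(r)$ such that $$\mathbb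 E\,\Delta(\mathcal P_{\mathbf\Omega^*})=\min_{\mathbf\Omega\in\mathfrak P_N(r)}\mathbb E\,\Delta(\mathcal P_{\mathbf\Omega}).$$ Likewise there is a partition $\mathbf\Omega^{*}\in\mathfrak P_N^{\mathrm{conv}}$ such that $$\mathbb E\,\Delta(\mathcal P_{\mathbf\Omega^*})=\min_{\mathbf\Omega\in\mathfrak P_N^{\mathrm{conv}}}\mathbb E\,\Delta(\mathcal P_{\mathbf\Omega}).$$ -/

import Mathlib

open MeasureTheory

/-- The unit cube `[0,1]^d` in Euclidean space `ℝ^d`. -/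
def unitCube (d : ℕ) : Set (EuclideanSpace ℝ (Fin d)) :=
  {x | ∀ k, 0 ≤ x k ∧ x k ≤ 1}

/-- `A` has reach at least `r`: every point at distance less than `r` from `A` has a unique
closest point in `A`. (`Metric.thickening r A` is the set of points at distance `< r` from `A`.) -/
def HasReachAtLeast {d : ℕ} (r : ℝ) (A : Set (EuclideanSpace ℝ (Fin d))) : Prop :=
  ∀ x ∈ Metric.thickening r A, ∃ y ∈ A, ∀ z ∈ A, z ≠ y → dist x y < dist x z

/-- `Ω = (Ω_1, …, Ω_N)` is an equivolume partition of the unit cube: Lebesgue-measurable sets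
with union `[0,1]^d`, pairwise overlapping in null sets only, and all of the same volume. -/
structure IsEquivolumePartition {d N : ℕ} (Ω : Fin N → Set (EuclideanSpace ℝ (Fin d))) :
    Prop where
  nullMeasurable : ∀ i, NullMeasurableSet (Ω i) volume
  iUnion_eq : ⋃ i, Ω i = unitCube d
  null_overlap : ∀ i j, i ≠ j → volume (Ω i ∩ Ω j) = 0
  equal_volume : ∀ i j, volume (Ω i) = volume (Ω j)

/-- The equivolume partitions of `[0,1]^d` into `N` nonempty compact sets of reach
at least `r`. -/
def reachPartitions (d N : ℕ) (r : ℝ) : Set (Fin N → Set (EuclideanSpace ℝ (Fin d))) :=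
  {Ω | IsEquivolumePartition Ω ∧
    ∀ i, (Ω i).Nonempty ∧ IsCompact (Ω i) ∧ HasReachAtLeast r (Ω i)}

/-- The equivolume partitions of `[0,1]^d` into `N` nonempty compact convex sets. -/
def convexPartitions (d N : ℕ) : Set (Fin N → Set (EuclideanSpace ℝ (Fin d))) :=
  {Ω | IsEquivolumePartition Ω ∧
    ∀ i, (Ω i).Nonempty ∧ IsCompact (Ω i) ∧ Convex ℝ (Ω i)}

/-- Lebesgue measure on the unit cube, as a measure on the subtype. -/
noncomputable def cubeVolume (d : ℕ) : Measure (unitCube d) :=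
  Measure.comap Subtype.val (volume : Measure (EuclideanSpace ℝ (Fin d)))

/-- The law, on `([0,1]^d)^N`, of the stratified sample `(X_1, …, X_N)`: the points are
independent, and `X_i` has the normalized Lebesgue measure on `Ω_i` as its distribution. -/
noncomputable def stratifiedLaw {d N : ℕ} (Ω : Fin N → Set (EuclideanSpace ℝ (Fin d))) :
    Measure (Fin N → unitCube d) :=
  Measure.pi fun i =>
    ProbabilityTheory.cond (cubeVolume d)
      ((Subtype.val : unitCube d → EuclideanSpace ℝ (Fin d)) ⁻¹' Ω i)

/-- The mean `Δ`-discrepancy of the stratified sample of `Ω`. -/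
noncomputable def meanDiscrepancy {d N : ℕ} (Δ : (Fin N → unitCube d) → ℝ)
    (Ω : Fin N → Set (EuclideanSpace ℝ (Fin d))) : ℝ :=
  ∫ x, Δ x ∂(stratifiedLaw Ω)

/-! This is the direct method: take a minimizing sequence of partitions, extract a
Hausdorff-convergent subsequence of their cells by Blaschke selection, and check that the limit is
admissible and attains the infimum. Reach, being a uniqueness condition, does not pass to limits
visibly. It is traded for `ExtendsDistance`, a condition on the distance function that survives by
compactness of balls. Hausdorff convergence alone does not preserve volume. For sets satisfying
`ExtendsDistance r` it does: the frontier of the limit is null (`ExtendsDistance.volume_frontier`),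
and off it membership stabilizes (`HausdorffLimit.eventually_mem_iff`). So indicators converge
almost everywhere, which preserves the equivolume conditions and, by dominated convergence, gives
continuity of the mean discrepancy without any continuity of `Δ`. Convex sets have every reach, so
the convex class is a subclass closed under Hausdorff limits. -/

open Metric Filter Topology

/-! ### Reach as a growth property of the distance function. -/

/-- Every point outside `A` at distance `< s < r` from `A` can be moved straight away from `A`
until its distance from `A` is `s`. For compact sets this is equivalent to having reach at
least `r`. -/
def ExtendsDistance {d : ℕ} (r : ℝ) (A : Set (EuclideanSpace ℝ (Fin d))) : Prop :=
  ∀ x s, 0 < infDist x A → infDist x A < s → s < r →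
    ∃ z, dist z x ≤ s - infDist x A ∧ s ≤ infDist z A

/-- The distance function of a compact set grows at rate arbitrarily close to one at each point
outside the set that has a unique closest point. -/
lemma exists_infDist_growth {d : ℕ} {A : Set (EuclideanSpace ℝ (Fin d))} (hA : IsCompact A)
    {z p : EuclideanSpace ℝ (Fin d)} (hp : p ∈ A) (hz : 0 < infDist z A)
    (huniq : ∀ y ∈ A, y ≠ p → dist z p < dist z y)
    {c : ℝ} (hc0 : 0 ≤ c) (hc1 : c < 1) {η : ℝ} (hη : 0 < η) :
    ∃ z', 0 < dist z' z ∧ dist z' z < η ∧ infDist z A + c * dist z' z ≤ infDist z' A := by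
  have hne : A.Nonempty := ⟨p, hp⟩
  set f := infDist z A with hf
  have hfp : dist z p = f := by
    obtain ⟨y, hy, hyd⟩ := hA.exists_infDist_eq_dist hne z
    by_cases h : y = p
    · rw [← h, ← hyd]
    · exact absurd (infDist_le_dist_of_mem hp) (not_le.2 (hf ▸ hyd ▸ huniq y hy h))
  set v : EuclideanSpace ℝ (Fin d) := (1 / f) • (z - p) with hv
  have hv1 : ‖v‖ = 1 := by
    rw [hv, norm_smul, ← dist_eq_norm, hfp, Real.norm_of_nonneg (by positivity)]
    field_simp
  have hvp : inner ℝ v (z - p) = f := by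
    rw [hv, real_inner_smul_left, real_inner_self_eq_norm_sq, ← dist_eq_norm, hfp]
    field_simp
  -- These are the points of `A` seen from `z` in directions far from that of `p`; uniqueness of `p`
  -- and compactness keep them at distance at least `f + g`.
  set K := A ∩ {y | inner ℝ v (z - y) ≤ c * f}
  have hK : IsCompact K := hA.inter_right (isClosed_le (by fun_prop) (by fun_prop))
  have hpK : ∀ y ∈ K, y ≠ p := by
    rintro y ⟨-, hy⟩ rfl
    change inner ℝ v (z - y) ≤ c * f at hy
    rw [hvp] at hy
    nlinarith
  obtain ⟨g, hg, hgK⟩ : ∃ g > 0, ∀ y ∈ K, f + g ≤ dist z y := by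
    rcases K.eq_empty_or_nonempty with h | h
    · exact ⟨1, one_pos, by simp [h]⟩
    · obtain ⟨y, hy, hyd⟩ := hK.exists_infDist_eq_dist h z
      refine ⟨dist z y - f, ?_, fun w hw => ?_⟩
      · have := huniq y hy.1 (hpK y hy)
        linarith
      · have := infDist_le_dist_of_mem (x := z) hw
        linarith
  -- A closest point to `z + h • v` lies within `f + 2 * h < f + g` of `z`, hence outside `K`.
  set h := min (g / 3) (η / 2)
  have hh : 0 < h := by positivity
  have hhg : h ≤ g / 3 := min_le_left _ _
  have hhη : h ≤ η / 2 := min_le_right _ _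
  have hd : dist (z + h • v) z = h := by
    rw [dist_eq_norm, add_sub_cancel_left, norm_smul, hv1, Real.norm_of_nonneg hh.le, mul_one]
  refine ⟨z + h • v, by rw [hd]; exact hh, by rw [hd]; linarith, ?_⟩
  rw [hd]
  obtain ⟨q, hq, hqd⟩ := hA.exists_infDist_eq_dist hne (z + h • v)
  have h1 : infDist (z + h • v) A ≤ f + h := by
    have := infDist_le_infDist_add_dist (s := A) (x := z + h • v) (y := z)
    rwa [hd] at this
  have h2 : c * f < inner ℝ v (z - q) := by
    by_contra hcon
    have h3 := hgK q ⟨hq, not_lt.1 hcon⟩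
    have h4 := dist_triangle z (z + h • v) q
    rw [dist_comm z (z + h • v), hd, ← hqd] at h4
    linarith
  have h5 : f ≤ dist z q := infDist_le_dist_of_mem hq
  have h6 : dist (z + h • v) q ^ 2 = dist z q ^ 2 + 2 * h * inner ℝ v (z - q) + h ^ 2 := by
    rw [dist_eq_norm, dist_eq_norm, show z + h • v - q = (z - q) + h • v by abel,
      norm_add_sq_real, norm_smul, hv1, Real.norm_of_nonneg hh.le, real_inner_smul_right,
      real_inner_comm]
    ring
  rw [hqd]
  refine abs_le_of_sq_le_sq' ?_ dist_nonneg |>.2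
  rw [h6]
  nlinarith [mul_lt_mul_of_pos_left h2 hh, mul_self_le_mul_self hz.le h5,
    mul_nonneg (sq_nonneg h) (show 0 ≤ 1 - c ^ 2 by nlinarith)]

/-- For `c < 1`, maximize `infDist z A - c * dist z x` over the ball of radius `s - t`. A maximizer
inside the open ball would contradict growth at a rate above `c`, so it lies on the sphere; then `c`
tends to one. -/
lemma HasReachAtLeast.extendsDistance {d : ℕ} {r : ℝ} {A : Set (EuclideanSpace ℝ (Fin d))}
    (hA : IsCompact A) (hne : A.Nonempty) (h : HasReachAtLeast r A) : ExtendsDistance r A := by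
  intro x s ht hts hsr
  set t := infDist x A
  have hcont : Continuous fun z => infDist z A := continuous_infDist_pt A
  have hball : IsCompact (closedBall x (s - t)) := isCompact_closedBall _ _
  have hballne : (closedBall x (s - t)).Nonempty := ⟨x, mem_closedBall_self (by linarith)⟩
  have key : ∀ c : ℝ, 0 ≤ c → c < 1 → ∃ z ∈ closedBall x (s - t), t + c * (s - t) ≤ infDist z A := by
    intro c hc0 hc1
    obtain ⟨z, hz, hzmax⟩ := hball.exists_isMaxOn hballne
      (f := fun z => infDist z A - c * dist z x) (by fun_prop)
    have h0 : t ≤ infDist z A - c * dist z x := by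
      simpa [t] using hzmax (mem_closedBall_self (by linarith) : x ∈ closedBall x (s - t))
    rcases (mem_closedBall.1 hz).lt_or_eq with hlt | heq
    · exfalso
      have hzt : infDist z A < r := by
        have := infDist_le_infDist_add_dist (s := A) (x := z) (y := x)
        linarith
      have hz0 : 0 < infDist z A := by
        have : 0 ≤ c * dist z x := by positivity
        linarith
      obtain ⟨p, hp, hpu⟩ := h z ((mem_thickening_iff_infDist_lt hne).2 hzt)
      obtain ⟨z', hz'0, hz'1, hz'2⟩ := exists_infDist_growth hA hp hz0 hpu
        (c := (1 + c) / 2) (by linarith) (by linarith) (η := s - t - dist z x) (by linarith)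
      have htri := dist_triangle z' z x
      have hmem : z' ∈ closedBall x (s - t) := by rw [mem_closedBall]; linarith
      have hle : infDist z' A - c * dist z' x ≤ infDist z A - c * dist z x := hzmax hmem
      nlinarith [mul_le_mul_of_nonneg_left htri hc0, mul_pos hz'0 (sub_pos.2 hc1)]
    · exact ⟨z, hz, by rw [heq] at h0; linarith⟩
  obtain ⟨z, hz, hzmax⟩ := hball.exists_isMaxOn hballne (f := fun z => infDist z A) (by fun_prop)
  refine ⟨z, hz, ?_⟩
  by_contra! hcon
  have hm : 0 < s - t := by linarith
  have hzx : t ≤ infDist z A := hzmax (mem_closedBall_self hm.le : x ∈ closedBall x (s - t))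
  -- The rate is the mean of 1 and the rate reached by the maximizer `z`, so `w` would beat `z`.
  obtain ⟨w, hw, hwc⟩ := key (((infDist z A - t) / (s - t) + 1) / 2)
    (by have : 0 ≤ (infDist z A - t) / (s - t) := div_nonneg (by linarith) hm.le
        linarith)
    (by have : (infDist z A - t) / (s - t) < 1 := (div_lt_one hm).2 (by linarith)
        linarith)
  have h1 : infDist w A ≤ infDist z A := hzmax hw
  have h2 : ((infDist z A - t) / (s - t) + 1) / 2 * (s - t) = ((infDist z A - t) + (s - t)) / 2 := by
    field_simp
  linarith

/-- The displacement `z - x` has length at most `s - t` yet gains the full `s - t` in distance, so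
it must point straight away from every closest point of `x`. Two closest points then coincide, by
the parallelogram law. -/
lemma ExtendsDistance.hasReachAtLeast {d : ℕ} {r : ℝ} {A : Set (EuclideanSpace ℝ (Fin d))}
    (hA : IsCompact A) (hne : A.Nonempty) (h : ExtendsDistance r A) : HasReachAtLeast r A := by
  intro x hx
  rw [mem_thickening_iff_infDist_lt hne] at hx
  obtain ⟨p, hp, hpd⟩ := hA.exists_infDist_eq_dist hne x
  refine ⟨p, hp, fun q hq hqp => ?_⟩
  by_contra! hle
  have hqd : dist x q = infDist x A := le_antisymm (hpd ▸ hle) (infDist_le_dist_of_mem hq)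
  rcases (infDist_nonneg : 0 ≤ infDist x A).eq_or_lt with h0 | h0
  · rw [← h0] at hpd hqd
    exact hqp ((dist_eq_zero.1 hqd).symm.trans (dist_eq_zero.1 hpd.symm))
  set t := infDist x A
  set s := (t + r) / 2
  obtain ⟨z, hz, hzs⟩ := h x s h0 (by simp only [s]; linarith) (by simp only [s]; linarith)
  have hinner : ∀ y ∈ A, dist x y = t → (s - t) * t ≤ inner ℝ (z - x) (x - y) := by
    intro y hy hyt
    have h1 : s ≤ dist z y := hzs.trans (infDist_le_dist_of_mem hy)
    have h2 : dist z y ^ 2 = dist z x ^ 2 + 2 * inner ℝ (z - x) (x - y) + dist x y ^ 2 := by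
      rw [dist_eq_norm, dist_eq_norm, dist_eq_norm, ← norm_add_sq_real]
      congr 2
      abel
    rw [hyt] at h2
    have hz0 : 0 ≤ dist z x := dist_nonneg
    nlinarith
  have hm : 0 < s - t := by simp only [s]; linarith
  have h1 := hinner p hp hpd.symm
  have h2 := hinner q hq hqd
  have h3 : inner ℝ (z - x) ((x - p) + (x - q)) ≤ (s - t) * ‖(x - p) + (x - q)‖ := by
    refine (real_inner_le_norm _ _).trans ?_
    rw [← dist_eq_norm]
    gcongr
  rw [inner_add_right] at h3
  have h4 : 2 * t ≤ ‖(x - p) + (x - q)‖ := by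
    refine le_of_mul_le_mul_left ?_ hm
    linarith
  have h5 := parallelogram_law_with_norm ℝ (x - p) (x - q)
  rw [← dist_eq_norm x p, ← dist_eq_norm x q, hqd, ← hpd] at h5
  have h6 : 0 < ‖(x - p) - (x - q)‖ := norm_pos_iff.2 fun h7 => hqp (by simpa [sub_eq_zero] using h7)
  nlinarith

/-! ### Properties preserved by Hausdorff limits. -/

lemma abs_infDist_sub_infDist_le {d : ℕ} {A B : Set (EuclideanSpace ℝ (Fin d))}
    (hA : IsCompact A) (hAne : A.Nonempty) (hB : IsCompact B) (hBne : B.Nonempty)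
    (x : EuclideanSpace ℝ (Fin d)) : |infDist x A - infDist x B| ≤ hausdorffDist A B := by
  have hfin : hausdorffEDist A B ≠ ⊤ :=
    hausdorffEDist_ne_top_of_nonempty_of_bounded hAne hBne hA.isBounded hB.isBounded
  have h1 := infDist_le_infDist_add_hausdorffDist (x := x) hfin
  have h2 := infDist_le_infDist_add_hausdorffDist (x := x) (s := B) (t := A)
    (by rwa [hausdorffEDist_comm])
  rw [hausdorffDist_comm] at h2
  rw [abs_le]
  constructor <;> linarith

/-- Convergence of a sequence of nonempty compact sets to a nonempty compact set in the Hausdorff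
metric. -/
structure HausdorffLimit {d : ℕ} (K : ℕ → Set (EuclideanSpace ℝ (Fin d)))
    (A : Set (EuclideanSpace ℝ (Fin d))) : Prop where
  isCompact : ∀ n, IsCompact (K n)
  nonempty : ∀ n, (K n).Nonempty
  isCompact_limit : IsCompact A
  nonempty_limit : A.Nonempty
  tendsto : Tendsto (fun n => hausdorffDist (K n) A) atTop (𝓝 0)

namespace HausdorffLimit

variable {d : ℕ} {K : ℕ → Set (EuclideanSpace ℝ (Fin d))} {A : Set (EuclideanSpace ℝ (Fin d))}

lemma abs_infDist_le (h : HausdorffLimit K A) (n : ℕ) (x : EuclideanSpace ℝ (Fin d)) :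
    |infDist x (K n) - infDist x A| ≤ hausdorffDist (K n) A :=
  abs_infDist_sub_infDist_le (h.isCompact n) (h.nonempty n) h.isCompact_limit h.nonempty_limit x

lemma tendsto_infDist (h : HausdorffLimit K A) (x : EuclideanSpace ℝ (Fin d)) :
    Tendsto (fun n => infDist x (K n)) atTop (𝓝 (infDist x A)) :=
  tendsto_iff_norm_sub_tendsto_zero.2 <|
    squeeze_zero (fun _ => norm_nonneg _) (fun n => h.abs_infDist_le n x) h.tendsto

lemma mem_iff_infDist_eq_zero (h : HausdorffLimit K A) {x : EuclideanSpace ℝ (Fin d)} :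
    x ∈ A ↔ infDist x A = 0 :=
  h.isCompact_limit.isClosed.mem_iff_infDist_zero h.nonempty_limit

lemma extendsDistance (h : HausdorffLimit K A) {r : ℝ} (hK : ∀ n, ExtendsDistance r (K n)) :
    ExtendsDistance r A := by
  intro x s ht hts hsr
  have hev : ∀ᶠ n in atTop, ∃ z, dist z x ≤ s - infDist x (K n) ∧ s ≤ infDist z (K n) := by
    filter_upwards [(h.tendsto_infDist x).eventually_const_lt ht,
      (h.tendsto_infDist x).eventually_lt_const hts] with n h1 h2 using hK n x s h1 h2 hsr
  obtain ⟨n₀, hn₀⟩ := eventually_atTop.1 hev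
  choose! z hz using fun n (hn : n₀ ≤ n) => hn₀ n hn
  have hball : ∀ n, z (n + n₀) ∈ closedBall x s := fun n =>
    (hz _ (Nat.le_add_left _ _)).1.trans (sub_le_self _ infDist_nonneg)
  obtain ⟨w, -, φ, hφ, hw⟩ := (isCompact_closedBall x s).tendsto_subseq hball
  have hψ : Tendsto (fun n => φ n + n₀) atTop atTop :=
    (tendsto_add_atTop_nat n₀).comp hφ.tendsto_atTop
  refine ⟨w, ?_, ?_⟩
  · exact le_of_tendsto_of_tendsto' (hw.dist tendsto_const_nhds)
      (tendsto_const_nhds.sub ((h.tendsto_infDist x).comp hψ))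
      fun n => (hz _ (Nat.le_add_left _ _)).1
  · have hlim : Tendsto (fun n => infDist (z (φ n + n₀)) A + hausdorffDist (K (φ n + n₀)) A)
        atTop (𝓝 (infDist w A + 0)) :=
      (((continuous_infDist_pt A).tendsto w).comp hw).add (h.tendsto.comp hψ)
    rw [add_zero] at hlim
    refine ge_of_tendsto' hlim fun n => ?_
    have h1 := (hz (φ n + n₀) (Nat.le_add_left _ _)).2
    have h2 := (abs_le.1 (h.abs_infDist_le (φ n + n₀) (z (φ n + n₀)))).2
    linarith

lemma hasReachAtLeast (h : HausdorffLimit K A) {r : ℝ} (hK : ∀ n, HasReachAtLeast r (K n)) :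
    HasReachAtLeast r A :=
  (h.extendsDistance fun n => (hK n).extendsDistance (h.isCompact n) (h.nonempty n)).hasReachAtLeast
    h.isCompact_limit h.nonempty_limit

/-- `A` lies in the closed thickening of `K n` by their Hausdorff distance, and thickenings of
convex sets are convex. -/
lemma convex (h : HausdorffLimit K A) (hK : ∀ n, Convex ℝ (K n)) : Convex ℝ A := by
  intro x hx y hy a b ha hb hab
  rw [h.mem_iff_infDist_eq_zero]
  refine tendsto_nhds_unique (h.tendsto_infDist _) (squeeze_zero (fun _ => infDist_nonneg)
    (fun n => ?_) h.tendsto)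
  have hmem : ∀ w ∈ A, w ∈ cthickening (hausdorffDist (K n) A) (K n) := by
    intro w hw
    rw [cthickening_eq_preimage_infEDist, Set.mem_preimage, Set.mem_Iic,
      ← ENNReal.ofReal_toReal (infEDist_ne_top (h.nonempty n))]
    refine ENNReal.ofReal_le_ofReal ?_
    have h1 := h.abs_infDist_le n w
    rw [h.mem_iff_infDist_eq_zero.1 hw, sub_zero, abs_of_nonneg infDist_nonneg] at h1
    exact h1
  have h2 := (hK n).cthickening (hausdorffDist (K n) A) (hmem x hx) (hmem y hy) ha hb hab
  exact ENNReal.toReal_le_of_le_ofReal hausdorffDist_nonneg h2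

/-- Membership in Hausdorff-convergent sets of reach at least `r` stabilizes off the frontier of
the limit. -/
lemma eventually_mem_iff (h : HausdorffLimit K A) {r : ℝ} (hr : 0 < r)
    (hK : ∀ n, ExtendsDistance r (K n)) {x : EuclideanSpace ℝ (Fin d)} (hx : x ∉ frontier A) :
    ∀ᶠ n in atTop, x ∈ K n ↔ x ∈ A := by
  by_cases hxA : x ∈ A
  · have hint : x ∈ interior A := by
      by_contra hcon
      exact hx ⟨subset_closure hxA, hcon⟩
    obtain ⟨δ, hδ, hball⟩ := isOpen_iff.1 isOpen_interior x hint
    have hs : 0 < min r δ / 2 := by positivity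
    have hsr : min r δ / 2 < r := by have := min_le_left r δ; linarith
    have hsδ : min r δ / 2 < δ := by have := min_le_right r δ; linarith
    filter_upwards [h.tendsto.eventually_lt_const hs] with n hn
    refine iff_of_true ?_ hxA
    have hsmall : ∀ w ∈ A, infDist w (K n) < min r δ / 2 := by
      intro w hw
      have h1 := h.abs_infDist_le n w
      rw [h.mem_iff_infDist_eq_zero.1 hw, sub_zero, abs_of_nonneg infDist_nonneg] at h1
      linarith
    rw [(h.isCompact n).isClosed.mem_iff_infDist_zero (h.nonempty n)]
    by_contra hne
    -- If `K n` missed `x`, one could move away from `K n` while staying in `A`, farther than the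
    -- Hausdorff distance allows.
    obtain ⟨z, hz1, hz2⟩ := hK n x _ (infDist_nonneg.lt_of_ne' hne) (hsmall x hxA) hsr
    have hzA : z ∈ A := interior_subset (hball (mem_ball.2
      (lt_of_le_of_lt (hz1.trans (sub_le_self _ infDist_nonneg)) hsδ)))
    exact absurd (hsmall z hzA) (not_lt.2 hz2)
  · have h0 : 0 < infDist x A :=
      infDist_nonneg.lt_of_ne' fun h0 => hxA (h.mem_iff_infDist_eq_zero.2 h0)
    filter_upwards [(h.tendsto_infDist x).eventually_const_lt h0] with n hn
    refine iff_of_false (fun hxK => ?_) hxA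
    rw [infDist_zero_of_mem hxK] at hn
    exact lt_irrefl _ hn

end HausdorffLimit

/-! ### Null frontiers, and the reach of convex sets. -/

/-- The frontier of a closed set of positive reach is a Lebesgue null set. -/
lemma ExtendsDistance.volume_frontier {d : ℕ} {r : ℝ} (hr : 0 < r)
    {A : Set (EuclideanSpace ℝ (Fin d))} (hA : IsClosed A) (hne : A.Nonempty)
    (h : ExtendsDistance r A) : volume (frontier A) = 0 := by
  have hdens := IsUnifLocDoublingMeasure.ae_tendsto_measure_inter_div
    (volume : Measure (EuclideanSpace ℝ (Fin d))) A 3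
  rw [ae_restrict_iff' hA.measurableSet] at hdens
  refine measure_mono_null (fun x hx => ?_) (ae_iff.1 hdens)
  have hxA : x ∈ A := hA.frontier_subset hx
  change ¬ (x ∈ A → _)
  intro hcon
  -- Near a frontier point there are balls of radius `ρ` missing `A` whose threefold dilates contain
  -- `x`. Density 0 along them contradicts Lebesgue's density theorem, which gives 1 almost
  -- everywhere on `A`.
  have hball : ∀ n : ℕ, ∃ z, x ∈ closedBall z (3 * (r / (4 * (n + 1)))) ∧
      A ∩ closedBall z (r / (4 * (n + 1))) = ∅ := by
    intro n
    set ρ := r / (4 * ((n : ℝ) + 1)) with hρ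
    have hρ0 : 0 < ρ := by positivity
    have hρr : 2 * ρ < r := by
      rw [hρ, ← mul_div_assoc, div_lt_iff₀ (by positivity)]
      nlinarith [(n.cast_nonneg : (0 : ℝ) ≤ n)]
    have hxc : x ∈ closure Aᶜ := by
      rw [frontier_eq_closure_inter_closure] at hx
      exact hx.2
    obtain ⟨y, hy, hyx⟩ := mem_closure_iff.1 hxc ρ hρ0
    have hy0 : 0 < infDist y A := (hA.notMem_iff_infDist_pos hne).1 hy
    have hy1 : infDist y A ≤ dist y x := infDist_le_dist_of_mem hxA
    rw [dist_comm] at hyx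
    obtain ⟨z, hz1, hz2⟩ := h y (2 * ρ) hy0 (by linarith) hρr
    refine ⟨z, ?_, ?_⟩
    · rw [mem_closedBall]
      have h1 := dist_triangle x y z
      rw [dist_comm x y, dist_comm y z] at h1
      linarith
    · rw [Set.eq_empty_iff_forall_notMem]
      rintro w ⟨hw, hwz⟩
      have h1 := infDist_le_dist_of_mem (x := z) hw
      rw [mem_closedBall, dist_comm] at hwz
      linarith
  choose z hz1 hz2 using hball
  have hδ : Tendsto (fun n : ℕ => r / (4 * ((n : ℝ) + 1))) atTop (𝓝[>] 0) := by
    refine tendsto_nhdsWithin_iff.2 ⟨?_, Eventually.of_forall fun n => ?_⟩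
    · refine tendsto_const_nhds.div_atTop (Tendsto.const_mul_atTop (by norm_num) ?_)
      exact tendsto_atTop_add_const_right _ _ tendsto_natCast_atTop_atTop
    · exact Set.mem_Ioi.2 (by positivity)
  have hlim := hcon hxA z _ hδ (Eventually.of_forall hz1)
  simp only [hz2, measure_empty, ENNReal.zero_div] at hlim
  exact zero_ne_one (tendsto_nhds_unique tendsto_const_nhds hlim)

/-- The midpoint of two distinct closest points would be strictly closer. -/
lemma Convex.hasReachAtLeast {d : ℕ} {A : Set (EuclideanSpace ℝ (Fin d))} (hA : Convex ℝ A)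
    (hc : IsCompact A) (hne : A.Nonempty) (r : ℝ) : HasReachAtLeast r A := by
  intro x _
  obtain ⟨p, hp, hpd⟩ := hc.exists_infDist_eq_dist hne x
  refine ⟨p, hp, fun q hq hqp => ?_⟩
  by_contra! hle
  have hmid : (1 / 2 : ℝ) • p + (1 / 2 : ℝ) • q ∈ A :=
    hA hp hq (by norm_num) (by norm_num) (by norm_num)
  have h1 : dist x p ≤ dist x ((1 / 2 : ℝ) • p + (1 / 2 : ℝ) • q) :=
    hpd ▸ infDist_le_dist_of_mem hmid
  have h2 : dist x ((1 / 2 : ℝ) • p + (1 / 2 : ℝ) • q) = 1 / 2 * ‖(x - p) + (x - q)‖ := by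
    rw [dist_eq_norm, show x - ((1 / 2 : ℝ) • p + (1 / 2 : ℝ) • q)
      = (1 / 2 : ℝ) • ((x - p) + (x - q)) by module, norm_smul]
    norm_num
  have h3 := parallelogram_law_with_norm ℝ (x - p) (x - q)
  rw [← dist_eq_norm x p, ← dist_eq_norm x q] at h3
  have h4 : 0 < ‖(x - p) - (x - q)‖ :=
    norm_pos_iff.2 fun h5 => hqp (by simpa [sub_eq_zero] using h5)
  have h5 : 0 ≤ dist x p := dist_nonneg
  have h6 : 0 ≤ dist x q := dist_nonneg
  nlinarith

/-! ### Boxes, the cube, and the partition into slabs. -/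

lemma volume_box {d : ℕ} (a b : Fin d → ℝ) :
    volume {x : EuclideanSpace ℝ (Fin d) | ∀ k, a k ≤ x k ∧ x k ≤ b k}
      = ∏ k, ENNReal.ofReal (b k - a k) := by
  rw [← Real.volume_Icc_pi, ← (PiLp.volume_preserving_ofLp (Fin d)).measure_preimage
    measurableSet_Icc.nullMeasurableSet]
  congr 1
  ext x
  simp [Set.mem_Icc, Pi.le_def, forall_and]

lemma isCompact_box {d : ℕ} (a b : Fin d → ℝ) :
    IsCompact {x : EuclideanSpace ℝ (Fin d) | ∀ k, a k ≤ x k ∧ x k ≤ b k} := by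
  have h := (isCompact_Icc (a := a) (b := b)).image (PiLp.continuous_toLp 2 (fun _ : Fin d => ℝ))
  convert h using 1
  ext x
  constructor
  · intro hx
    exact ⟨x.ofLp, ⟨fun k => (hx k).1, fun k => (hx k).2⟩, rfl⟩
  · rintro ⟨y, hy, rfl⟩ k
    exact ⟨hy.1 k, hy.2 k⟩

lemma convex_box {d : ℕ} (a b : Fin d → ℝ) :
    Convex ℝ {x : EuclideanSpace ℝ (Fin d) | ∀ k, a k ≤ x k ∧ x k ≤ b k} := by
  intro x hx y hy s t hs ht hst k
  have := convex_Icc (a k) (b k) (hx k) (hy k) hs ht hst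
  simpa using this

lemma isCompact_unitCube (d : ℕ) : IsCompact (unitCube d) := isCompact_box _ _

lemma volume_unitCube (d : ℕ) : volume (unitCube d) = 1 := by
  have := volume_box (d := d) (fun _ => 0) (fun _ => 1)
  simpa [unitCube] using this

instance (d : ℕ) : CompactSpace (unitCube d) :=
  isCompact_iff_compactSpace.1 (isCompact_unitCube d)

lemma cubeVolume_preimage {d : ℕ} {A : Set (EuclideanSpace ℝ (Fin d))} (hA : A ⊆ unitCube d) :
    cubeVolume d (Subtype.val ⁻¹' A) = volume A := by
  rw [cubeVolume, (MeasurableEmbedding.subtype_coe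
    (isCompact_unitCube d).isClosed.measurableSet).comap_apply, Subtype.image_preimage_coe,
    Set.inter_eq_right.2 hA]

instance (d : ℕ) : IsProbabilityMeasure (cubeVolume d) :=
  ⟨by rw [← volume_unitCube d, ← cubeVolume_preimage subset_rfl, Subtype.coe_preimage_self]⟩

/-- The slabs `{x ∈ [0,1]^d : i/N ≤ x₀ ≤ (i+1)/N}` form an equivolume partition. -/
lemma convexPartitions_nonempty {d N : ℕ} (hd : 1 ≤ d) (hN : 1 ≤ N) :
    (convexPartitions d N).Nonempty := by
  have hN0 : (0 : ℝ) < N := by exact_mod_cast hN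
  let o : Fin d := ⟨0, hd⟩
  let box (s t : ℝ) : Set (EuclideanSpace ℝ (Fin d)) :=
    {x | ∀ k, Function.update (fun _ => (0 : ℝ)) o s k ≤ x k ∧
      x k ≤ Function.update (fun _ => (1 : ℝ)) o t k}
  have hmem : ∀ s t x, x ∈ box s t ↔ (s ≤ x o ∧ x o ≤ t) ∧ ∀ k ≠ o, 0 ≤ x k ∧ x k ≤ 1 := by
    intro s t x
    constructor
    · intro hx
      refine ⟨by simpa using hx o, fun k hk => by simpa [hk] using hx k⟩
    · rintro ⟨h1, h2⟩ k
      by_cases hk : k = o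
      · subst hk
        simpa using h1
      · simpa [hk] using h2 k hk
  have hvol : ∀ s t, volume (box s t) = ENNReal.ofReal (t - s) := by
    intro s t
    rw [volume_box, Finset.prod_eq_single o]
    · simp
    · intro k _ hk
      simp [hk]
    · simp
  let Ω : Fin N → Set (EuclideanSpace ℝ (Fin d)) := fun i => box (i / N) ((i + 1) / N)
  have hcomp : ∀ i, IsCompact (Ω i) := fun i => isCompact_box _ _
  have hnull : ∀ i j : Fin N, i < j → volume (Ω i ∩ Ω j) = 0 := by
    intro i j hij
    refine measure_mono_null (t := box (j / N) ((i + 1) / N)) ?_ ?_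
    · rintro x ⟨h1, h2⟩
      simp only [Ω, hmem] at h1 h2 ⊢
      exact ⟨⟨h2.1.1, h1.1.2⟩, h1.2⟩
    · rw [hvol, ENNReal.ofReal_eq_zero, sub_nonpos]
      gcongr
      exact_mod_cast hij
  refine ⟨Ω, ⟨fun i => (hcomp i).measurableSet.nullMeasurableSet, ?_, ?_, ?_⟩,
    fun i => ⟨?_, hcomp i, convex_box _ _⟩⟩
  · ext x
    simp only [Set.mem_iUnion, Ω, hmem]
    constructor
    · rintro ⟨i, ⟨h1, h2⟩, h3⟩ k
      by_cases hk : k = o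
      · subst hk
        refine ⟨le_trans (by positivity) h1, h2.trans ?_⟩
        rw [div_le_one hN0]
        exact_mod_cast i.isLt
      · exact h3 k hk
    · intro hx
      obtain ⟨h0, h1⟩ := hx o
      rcases h1.lt_or_eq with h1 | h1
      · have hxN : 0 ≤ x o * N := by positivity
        have hlt : ⌊x o * N⌋₊ < N := by
          rw [Nat.floor_lt hxN]
          nlinarith
        refine ⟨⟨⌊x o * N⌋₊, hlt⟩, ⟨?_, ?_⟩, fun k _ => hx k⟩
        · rw [div_le_iff₀ hN0]
          exact Nat.floor_le hxN
        · rw [le_div_iff₀ hN0]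
          exact (Nat.lt_floor_add_one _).le
      -- On the face `x o = 1` the floor would be `N`, so the last slab is chosen.
      · have hcast : ((N - 1 : ℕ) : ℝ) = N - 1 := by push_cast [hN]; ring
        refine ⟨⟨N - 1, by omega⟩, ⟨?_, ?_⟩, fun k _ => hx k⟩
        · rw [h1, div_le_one hN0, hcast]
          linarith
        · rw [h1, le_div_iff₀ hN0, hcast]
          linarith
  · intro i j hij
    rcases hij.lt_or_gt with h | h
    · exact hnull i j h
    · rw [Set.inter_comm]
      exact hnull j i h
  · intro i j
    simp only [Ω, hvol]
    congr 1
    ring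
  · refine ⟨WithLp.toLp 2 (Function.update (fun _ => (0 : ℝ)) o (i / N)), ?_⟩
    simp only [Ω, hmem]
    refine ⟨⟨by simp, ?_⟩, fun k hk => by simp [hk]⟩
    simp only [Function.update_self]
    gcongr
    linarith

/-! ### Compactness of the class of partitions. -/

/-- A Blaschke selection theorem for tuples of nonempty compact subsets of the unit cube. -/
lemma exists_hausdorffLimit_subseq {d N : ℕ} (Ω : ℕ → Fin N → Set (EuclideanSpace ℝ (Fin d)))
    (hc : ∀ n i, IsCompact (Ω n i)) (hne : ∀ n i, (Ω n i).Nonempty)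
    (hsub : ∀ n i, Ω n i ⊆ unitCube d) :
    ∃ (A : Fin N → Set (EuclideanSpace ℝ (Fin d))) (φ : ℕ → ℕ), StrictMono φ ∧
      (∀ i, A i ⊆ unitCube d) ∧ ∀ i, HausdorffLimit (fun n => Ω (φ n) i) (A i) := by
  let K : ℕ → Fin N → TopologicalSpace.NonemptyCompacts (unitCube d) := fun n i =>
    { carrier := Subtype.val ⁻¹' Ω n i
      isCompact' := ((hc n i).isClosed.preimage continuous_subtype_val).isCompact
      nonempty' := by
        obtain ⟨x, hx⟩ := hne n i
        exact ⟨⟨x, hsub n i hx⟩, hx⟩ }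
  -- The nonempty compact subsets of the compact cube form a compact metric space, and so do
  -- `N`-tuples of them.
  obtain ⟨L, φ, hφ, hL⟩ := CompactSpace.tendsto_subseq K
  refine ⟨fun i => Subtype.val '' (L i : Set (unitCube d)), φ, hφ, fun i => ?_, fun i => ?_⟩
  · rintro _ ⟨x, -, rfl⟩
    exact x.2
  · refine ⟨fun n => hc _ i, fun n => hne _ i, (L i).isCompact.image continuous_subtype_val,
      (L i).nonempty.image _, ?_⟩
    have h := tendsto_iff_dist_tendsto_zero.1 (tendsto_pi_nhds.1 hL i)
    refine h.congr fun n => ?_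
    rw [NonemptyCompacts.dist_eq, ← hausdorffDist_image isometry_subtype_coe]
    congr 1
    change Subtype.val '' (Subtype.val ⁻¹' Ω (φ n) i) = _
    rw [Subtype.image_preimage_coe, Set.inter_eq_right.2 (hsub _ i)]

/-- The Hausdorff limit of equivolume partitions of reach at least `r` is again one. -/
lemma mem_reachPartitions_of_hausdorffLimit {d N : ℕ} {r : ℝ} (hr : 0 < r)
    {Ω : ℕ → Fin N → Set (EuclideanSpace ℝ (Fin d))} (hΩ : ∀ n, Ω n ∈ reachPartitions d N r)
    {A : Fin N → Set (EuclideanSpace ℝ (Fin d))} (hA : ∀ i, A i ⊆ unitCube d)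
    (hlim : ∀ i, HausdorffLimit (fun n => Ω n i) (A i)) : A ∈ reachPartitions d N r := by
  have hext : ∀ i n, ExtendsDistance r (Ω n i) := fun i n =>
    ((hΩ n).2 i).2.2.extendsDistance ((hΩ n).2 i).2.1 ((hΩ n).2 i).1
  have hAc : ∀ i, IsCompact (A i) := fun i => (hlim i).isCompact_limit
  have hsub : ∀ n i, Ω n i ⊆ unitCube d := fun n i =>
    (Set.subset_iUnion (Ω n) i).trans (hΩ n).1.iUnion_eq.subset
  have hae : ∀ i, ∀ᵐ x, ∀ᶠ n in atTop, x ∈ Ω n i ↔ x ∈ A i := by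
    intro i
    have h0 := ((hlim i).extendsDistance (hext i)).volume_frontier hr (hAc i).isClosed
      (hlim i).nonempty_limit
    filter_upwards [measure_eq_zero_iff_ae_notMem.1 h0] with x hx
    exact (hlim i).eventually_mem_iff hr (hext i) hx
  have hcube : MeasurableSet (unitCube d) := (isCompact_unitCube d).isClosed.measurableSet
  have hfin : volume (unitCube d) ≠ ⊤ := by simp [volume_unitCube]
  have hmeas : ∀ n i, MeasurableSet (Ω n i) := fun n i => ((hΩ n).2 i).2.1.measurableSet
  have hvol : ∀ i, Tendsto (fun n => volume (Ω n i)) atTop (𝓝 (volume (A i))) := fun i =>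
    tendsto_measure_of_ae_tendsto_indicator atTop (hAc i).measurableSet (fun n => hmeas n i)
      hcube hfin (Eventually.of_forall fun n => hsub n i) (hae i)
  refine ⟨⟨fun i => (hAc i).measurableSet.nullMeasurableSet, ?_, fun i j hij => ?_,
    fun i j => ?_⟩, fun i => ⟨(hlim i).nonempty_limit, hAc i,
      (hlim i).hasReachAtLeast fun n => ((hΩ n).2 i).2.2⟩⟩
  · refine Set.Subset.antisymm (Set.iUnion_subset hA) fun x hx => ?_
    -- The product of the distances vanishes exactly when `x` lies in some cell, so covering passes
    -- to the limit.
    have h1 : Tendsto (fun n => ∏ i, infDist x (Ω n i)) atTop (𝓝 (∏ i, infDist x (A i))) :=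
      tendsto_finsetProd _ fun i _ => (hlim i).tendsto_infDist x
    have h2 : ∀ n, ∏ i, infDist x (Ω n i) = 0 := by
      intro n
      rw [← (hΩ n).1.iUnion_eq, Set.mem_iUnion] at hx
      obtain ⟨i, hi⟩ := hx
      exact Finset.prod_eq_zero (Finset.mem_univ i) (infDist_zero_of_mem hi)
    simp only [h2] at h1
    obtain ⟨i, -, hi⟩ := Finset.prod_eq_zero_iff.1 (tendsto_nhds_unique h1 tendsto_const_nhds)
    exact Set.mem_iUnion.2 ⟨i, (hlim i).mem_iff_infDist_eq_zero.2 hi⟩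
  · have h1 : Tendsto (fun n => volume (Ω n i ∩ Ω n j)) atTop (𝓝 (volume (A i ∩ A j))) := by
      refine tendsto_measure_of_ae_tendsto_indicator atTop
        ((hAc i).measurableSet.inter (hAc j).measurableSet)
        (fun n => (hmeas n i).inter (hmeas n j)) hcube hfin
        (Eventually.of_forall fun n => Set.inter_subset_left.trans (hsub n i)) ?_
      filter_upwards [hae i, hae j] with x hi hj
      filter_upwards [hi, hj] with n h1 h2
      exact and_congr h1 h2
    simp only [(hΩ _).1.null_overlap i j hij] at h1
    exact tendsto_nhds_unique h1 tendsto_const_nhds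
  · exact tendsto_nhds_unique (hvol i)
      ((hvol j).congr fun n => (hΩ n).1.equal_volume j i)

/-! ### Continuity of the mean discrepancy. -/

lemma IsEquivolumePartition.volume_eq {d N : ℕ} {Ω : Fin N → Set (EuclideanSpace ℝ (Fin d))}
    (hΩ : IsEquivolumePartition Ω) (i : Fin N) : volume (Ω i) = (N : ENNReal)⁻¹ := by
  have h1 := measure_iUnion₀ (μ := volume) (f := Ω) (fun i j hij => hΩ.null_overlap i j hij)
    hΩ.nullMeasurable
  rw [hΩ.iUnion_eq, volume_unitCube, tsum_fintype,
    Finset.sum_congr rfl fun j _ => hΩ.equal_volume j i] at h1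
  simp only [Finset.sum_const, Finset.card_univ, Fintype.card_fin, nsmul_eq_mul] at h1
  exact ENNReal.eq_inv_of_mul_eq_one_left (by rw [mul_comm]; exact h1.symm)

/-- Since all cells have volume `1/N`, the partition enters the law only through an indicator
against one fixed product measure; this is what makes dominated convergence applicable. -/
lemma stratifiedLaw_eq {d N : ℕ} {Ω : Fin N → Set (EuclideanSpace ℝ (Fin d))}
    (hΩ : IsEquivolumePartition Ω) :
    stratifiedLaw Ω = (N : ENNReal) ^ N •
      (Measure.pi fun _ : Fin N => cubeVolume d).restrict
        (Set.univ.pi fun i => Subtype.val ⁻¹' Ω i) := by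
  have hcond : ∀ i, ProbabilityTheory.cond (cubeVolume d) (Subtype.val ⁻¹' Ω i)
      = (N : ENNReal) • (cubeVolume d).restrict (Subtype.val ⁻¹' Ω i) := by
    intro i
    rw [ProbabilityTheory.cond, cubeVolume_preimage
      ((Set.subset_iUnion Ω i).trans hΩ.iUnion_eq.subset), hΩ.volume_eq, inv_inv]
  unfold stratifiedLaw
  refine Measure.pi_eq fun s _ => ?_
  simp only [hcond, Measure.restrict_pi_pi, Measure.smul_apply, Measure.pi_pi, smul_eq_mul,
    Finset.prod_mul_distrib, Finset.prod_const, Finset.card_univ, Fintype.card_fin]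

lemma meanDiscrepancy_eq {d N : ℕ} (Δ : (Fin N → unitCube d) → ℝ)
    {Ω : Fin N → Set (EuclideanSpace ℝ (Fin d))} (hΩ : IsEquivolumePartition Ω)
    (hm : ∀ i, MeasurableSet (Ω i)) :
    meanDiscrepancy Δ Ω = (N : ℝ) ^ N * ∫ x, (Set.univ.pi fun i => Subtype.val ⁻¹' Ω i).indicator Δ x
      ∂(Measure.pi fun _ : Fin N => cubeVolume d) := by
  rw [meanDiscrepancy, stratifiedLaw_eq hΩ, integral_smul_measure, integral_indicator
    (MeasurableSet.univ_pi fun i => measurable_subtype_coe (hm i))]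
  simp

lemma ae_cubeVolume {d : ℕ} {p : EuclideanSpace ℝ (Fin d) → Prop} (h : ∀ᵐ x, p x) :
    ∀ᵐ x ∂(cubeVolume d), p x.1 := by
  have hcube : MeasurableSet (unitCube d) := (isCompact_unitCube d).isClosed.measurableSet
  have h1 : ∀ᵐ x ∂((cubeVolume d).map Subtype.val), p x := by
    rw [cubeVolume, (MeasurableEmbedding.subtype_coe hcube).map_comap]
    exact ae_restrict_of_ae h
  exact ae_of_ae_map measurable_subtype_coe.aemeasurable h1

/-- The mean discrepancy is continuous along Hausdorff-convergent partitions of reach at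
least `r`. -/
lemma tendsto_meanDiscrepancy {d N : ℕ} {r : ℝ} (hr : 0 < r) {Δ : (Fin N → unitCube d) → ℝ}
    (hmeas : NullMeasurable Δ (Measure.pi fun _ : Fin N => cubeVolume d))
    {C : ℝ} (hC : ∀ x, |Δ x| ≤ C)
    {Ω : ℕ → Fin N → Set (EuclideanSpace ℝ (Fin d))} (hΩ : ∀ n, Ω n ∈ reachPartitions d N r)
    {A : Fin N → Set (EuclideanSpace ℝ (Fin d))} (hA : A ∈ reachPartitions d N r)
    (hlim : ∀ i, HausdorffLimit (fun n => Ω n i) (A i)) :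
    Tendsto (fun n => meanDiscrepancy Δ (Ω n)) atTop (𝓝 (meanDiscrepancy Δ A)) := by
  simp only [meanDiscrepancy_eq Δ hA.1 fun i => (hA.2 i).2.1.measurableSet,
    meanDiscrepancy_eq Δ (hΩ _).1 fun i => ((hΩ _).2 i).2.1.measurableSet]
  refine Tendsto.const_mul _ ?_
  refine tendsto_integral_of_dominated_convergence (fun _ => C) (fun n => ?_)
    (integrable_const C) (fun n => ae_of_all _ fun x => ?_) ?_
  · exact hmeas.aemeasurable.aestronglyMeasurable.indicator
      (MeasurableSet.univ_pi fun i => measurable_subtype_coe ((hΩ n).2 i).2.1.measurableSet)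
  · exact (norm_indicator_le_norm_self _ _).trans (hC x)
  · have hae : ∀ᵐ x ∂(Measure.pi fun _ : Fin N => cubeVolume d), ∀ i,
        (x i).1 ∉ frontier (A i) := by
      refine ae_all_iff.2 fun i => ?_
      have h0 := ((hA.2 i).2.2.extendsDistance (hA.2 i).2.1 (hA.2 i).1).volume_frontier hr
        (hA.2 i).2.1.isClosed (hA.2 i).1
      exact (Measure.tendsto_eval_ae_ae (μ := fun _ : Fin N => cubeVolume d) (i := i)).eventually
        (ae_cubeVolume (measure_eq_zero_iff_ae_notMem.1 h0))
    filter_upwards [hae] with x hx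
    have hev : ∀ᶠ n in atTop, ∀ i, (x i).1 ∈ Ω n i ↔ (x i).1 ∈ A i :=
      eventually_all.2 fun i => (hlim i).eventually_mem_iff hr
        (fun n => ((hΩ n).2 i).2.2.extendsDistance ((hΩ n).2 i).2.1 ((hΩ n).2 i).1) (hx i)
    refine tendsto_const_nhds.congr' ?_
    filter_upwards [hev] with n hn
    have hiff : (x ∈ Set.univ.pi fun i => (Subtype.val ⁻¹' A i : Set (unitCube d))) ↔
        x ∈ Set.univ.pi fun i => (Subtype.val ⁻¹' Ω n i : Set (unitCube d)) := by
      simp [Set.mem_pi, hn]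
    by_cases hxA : x ∈ Set.univ.pi fun i => (Subtype.val ⁻¹' A i : Set (unitCube d))
    · rw [Set.indicator_of_mem hxA, Set.indicator_of_mem (hiff.1 hxA)]
    · rw [Set.indicator_of_notMem hxA, Set.indicator_of_notMem (mt hiff.2 hxA)]

/-! ### Existence of minimizers. -/

/-- The mean discrepancy attains its minimum on every nonempty class of partitions of reach at
least `r` that is closed under Hausdorff limits. -/
lemma exists_min_meanDiscrepancy {d N : ℕ} {r : ℝ} (hr : 0 < r) {Δ : (Fin N → unitCube d) → ℝ}
    (hmeas : NullMeasurable Δ (Measure.pi fun _ : Fin N => cubeVolume d))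
    {C : ℝ} (hC : ∀ x, |Δ x| ≤ C) {S : Set (Fin N → Set (EuclideanSpace ℝ (Fin d)))}
    (hS : S ⊆ reachPartitions d N r) (hne : S.Nonempty)
    (hclosed : ∀ (Ω : ℕ → Fin N → Set (EuclideanSpace ℝ (Fin d))), (∀ n, Ω n ∈ S) →
      ∀ A ∈ reachPartitions d N r, (∀ i, HausdorffLimit (fun n => Ω n i) (A i)) → A ∈ S) :
    ∃ Ω' ∈ S, ∀ Ω ∈ S, meanDiscrepancy Δ Ω' ≤ meanDiscrepancy Δ Ω := by
  have hbdd : BddBelow (meanDiscrepancy Δ '' S) := by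
    refine ⟨-((N : ℝ) ^ N * C), ?_⟩
    rintro _ ⟨Ω, hΩ, rfl⟩
    rw [meanDiscrepancy_eq Δ (hS hΩ).1 fun i => ((hS hΩ).2 i).2.1.measurableSet, ← mul_neg]
    refine mul_le_mul_of_nonneg_left ?_ (by positivity)
    have h1 := norm_integral_le_of_norm_le_const (μ := Measure.pi fun _ : Fin N => cubeVolume d)
      (f := (Set.univ.pi fun i => (Subtype.val ⁻¹' Ω i : Set (unitCube d))).indicator Δ)
      (ae_of_all _ fun x => (norm_indicator_le_norm_self _ _).trans (hC x))
    simp only [probReal_univ, mul_one] at h1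
    exact (abs_le.1 h1).1
  obtain ⟨u, -, hu, huS⟩ := exists_seq_tendsto_sInf (hne.image (meanDiscrepancy Δ)) hbdd
  choose Ω hΩS hΩu using huS
  have hΩ : ∀ n, Ω n ∈ reachPartitions d N r := fun n => hS (hΩS n)
  obtain ⟨A, φ, hφ, hAsub, hlim⟩ := exists_hausdorffLimit_subseq Ω
    (fun n i => ((hΩ n).2 i).2.1) (fun n i => ((hΩ n).2 i).1)
    (fun n i => (Set.subset_iUnion (Ω n) i).trans (hΩ n).1.iUnion_eq.subset)
  have hA : A ∈ reachPartitions d N r :=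
    mem_reachPartitions_of_hausdorffLimit hr (fun n => hΩ (φ n)) hAsub hlim
  refine ⟨A, hclosed _ (fun n => hΩS (φ n)) A hA hlim, fun Ω₁ hΩ₁ => ?_⟩
  have h1 := tendsto_meanDiscrepancy hr hmeas hC (fun n => hΩ (φ n)) hA hlim
  simp only [hΩu] at h1
  rw [tendsto_nhds_unique h1 (hu.comp hφ.tendsto_atTop)]
  exact csInf_le hbdd ⟨Ω₁, hΩ₁, rfl⟩

lemma convexPartitions_subset_reachPartitions (d N : ℕ) (r : ℝ) :
    convexPartitions d N ⊆ reachPartitions d N r := fun _ hΩ =>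
  ⟨hΩ.1, fun i => ⟨(hΩ.2 i).1, (hΩ.2 i).2.1,
    (hΩ.2 i).2.2.hasReachAtLeast (hΩ.2 i).2.1 (hΩ.2 i).1 r⟩⟩

theorem theorem2 (d N : ℕ) (hd : 1 ≤ d) (hN : 1 ≤ N) (r : ℝ) (hr : 0 < r)
    (Δ : (Fin N → unitCube d) → ℝ)
    (hmeas : NullMeasurable Δ (Measure.pi fun _ : Fin N => cubeVolume d))
    (hbdd : ∃ C : ℝ, ∀ x, |Δ x| ≤ C) :
    (∃ Ω' ∈ reachPartitions d N r,
      ∀ Ω ∈ reachPartitions d N r, meanDiscrepancy Δ Ω' ≤ meanDiscrepancy Δ Ω) ∧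
    (∃ Ω' ∈ convexPartitions d N,
      ∀ Ω ∈ convexPartitions d N, meanDiscrepancy Δ Ω' ≤ meanDiscrepancy Δ Ω) := by
  obtain ⟨C, hC⟩ := hbdd
  have hne := convexPartitions_nonempty hd hN
  have hsub := convexPartitions_subset_reachPartitions d N r
  -- In the convex case `r` is only auxiliary: any positive radius would serve.
  refine ⟨exists_min_meanDiscrepancy hr hmeas hC subset_rfl (hne.mono hsub)
    fun _ _ A hA _ => hA, exists_min_meanDiscrepancy hr hmeas hC hsub hne
    fun Ω hΩ A hA hlim => ⟨hA.1, fun i => ⟨(hA.2 i).1, (hA.2 i).2.1,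
      (hlim i).convex fun n => ((hΩ n).2 i).2.2⟩⟩⟩
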